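/- Let $p\ge 3$, $n\ge 1$ be integers, and for $\theta\in\mathbb R^p$, $\sigma>0$ let $X\sim N_p(\theta,\sigma^2 I_p)$ and $S\sim\sigma^2\chi^2_n$ be independent; put $W=\|X\|^2/S$. Let $\varphi$ be a real function that is absolutely continuous on every compact subinterval of $(0,\infty)$, and let $$\delta_\varphi=\Bigl(1-\frac{\varphi(W)}{W}\Bigr)X,\qquad R(\delta_\varphi)=E\|\delta_\varphi-\theta\|^2 .$$ Assume that $\delta_\varphi$ is at least as good as $X$ under squared error loss, i.e. $E\|\delta_\varphi-\theta\|^2\le E\|X-\theta\|^2$ for all $\theta$ and all $\sigma>0$, and that, with $h(t)=(p-2)\varphi(t)/t+2\varphi'(t)$, the integral in $$g(w)=w^{n/2}\int_w^\infty t^{-n/2}\,\frac{h(t)}{t}\,dt$$ converges absolutely for every $w>0$. Put $a(w)=\frac np\bigl(g(w)-\varphi(w)^2/w\bigr)$ and define $$\hat R_0(\delta_\varphi)=\frac{pS}{n}-S\,g(W)+\frac{S\varphi(W)^2}{W}=\frac{pS}{n}\bigl(1-a(W)\bigr),$$ $$\hat R(\psi_0;\delta_\varphi)=\min\Bigl[\max\bigl(\hat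 R_0(\delta_\varphi),0\bigr),\ \frac{pS(1+W)}{n+p+2}\Bigr].$$ Where $a(W)>0$, the latter equals $\frac{pS}{n}\bigl(1-a(W)\psi_0(W)\bigr)$ with $\psi_0=\max\bigl[\min(1,\tfrac1a),\ \tfrac1a\bigl(1-\tfrac{n(1+W)}{n+p+2}\bigr)\bigr]$. Let $$\mathcal B=\Bigl\{w>0:\ a(w)>0,\ \frac1{a(w)}\Bigl(1-\frac{n(1+w)}{n+p+2}\Bigr)>1\Bigr\}.$$ If $\mathcal B\ne\emptyset$, then $\hat R(\psi_0;\delta_\varphi)$ strictly improves on the truncated estimator $\max(0,\hat R_0(\delta_\varphi))$ as an estimator of $R(\delta_\varphi)$: for all $\theta\in\mathbb R^p$ and all $\sigma>0$, $$E\bigl(\hat R(\psi_0;\delta_\varphi)-R(\delta_\varphi)\bigr)^2<E\bigl(\max(0,\hat R_0(\delta_\varphi))-R(\delta_\varphi)\bigr)^2 ,$$ where the right-hand side may be $+\infty$. -/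

import Mathlib

open MeasureTheory ProbabilityTheory

noncomputable section

namespace ShrinkMSE

/-- Chi-square distribution with `n` degrees of freedom: the gamma law with shape `n / 2` and
rate `1 / 2`. -/
def chiSquared (n : ℕ) : Measure ℝ := gammaMeasure ((n : ℝ) / 2) (1 / 2)

/-- Joint law of `(X, S)`, where `X ∼ N_p(θ, σ² I_p)` and `S ∼ σ² χ²_n` are independent. -/
def model (p n : ℕ) (θ : EuclideanSpace ℝ (Fin p)) (σ : ℝ) :
    Measure (EuclideanSpace ℝ (Fin p) × ℝ) :=
  (multivariateGaussian θ (σ ^ 2 • (1 : Matrix (Fin p) (Fin p) ℝ))).prod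
    ((chiSquared n).map (fun u => σ ^ 2 * u))

/-- The statistic `W = ‖X‖² / S`. -/
def stat {p : ℕ} (x : EuclideanSpace ℝ (Fin p)) (s : ℝ) : ℝ := ‖x‖ ^ 2 / s

/-- The shrinkage estimator `δ_φ = (1 - φ(W) / W) X`. -/
def shrink {p : ℕ} (φ : ℝ → ℝ) (x : EuclideanSpace ℝ (Fin p)) (s : ℝ) :
    EuclideanSpace ℝ (Fin p) :=
  (1 - φ (stat x s) / stat x s) • x

/-- Squared error risk `E ‖δ(X, S) - θ‖²` of an estimator `δ` of `θ`, with values in `[0, ∞]`. -/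
def sqRisk (p n : ℕ) (δ : EuclideanSpace ℝ (Fin p) → ℝ → EuclideanSpace ℝ (Fin p))
    (θ : EuclideanSpace ℝ (Fin p)) (σ : ℝ) : ENNReal :=
  ∫⁻ z, ENNReal.ofReal (‖δ z.1 z.2 - θ‖ ^ 2) ∂(model p n θ σ)

/-- The mean squared error `R(δ_φ)`, as a real number. -/
def mse (p n : ℕ) (φ : ℝ → ℝ) (θ : EuclideanSpace ℝ (Fin p)) (σ : ℝ) : ℝ :=
  (sqRisk p n (shrink φ) θ σ).toReal

/-- `h(t) = (p - 2) φ(t) / t + 2 φ'(t)`. -/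
def hFun (p : ℕ) (φ : ℝ → ℝ) (t : ℝ) : ℝ := ((p : ℝ) - 2) * (φ t / t) + 2 * deriv φ t

/-- The integrand `t^(-n/2) h(t) / t` of `g`. -/
def gIntegrand (p n : ℕ) (φ : ℝ → ℝ) (t : ℝ) : ℝ := t ^ (-((n : ℝ) / 2)) * (hFun p φ t / t)

/-- `g(w) = w^(n/2) ∫_w^∞ t^(-n/2) (h(t) / t) dt`. -/
def gFun (p n : ℕ) (φ : ℝ → ℝ) (w : ℝ) : ℝ :=
  w ^ ((n : ℝ) / 2) * ∫ t in Set.Ioi w, gIntegrand p n φ t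

/-- `a(w) = (n / p) (g(w) - φ(w)² / w)`. -/
def aFun (p n : ℕ) (φ : ℝ → ℝ) (w : ℝ) : ℝ :=
  ((n : ℝ) / p) * (gFun p n φ w - φ w ^ 2 / w)

/-- The unbiased estimator `R̂₀(δ_φ) = p S / n - S g(W) + S φ(W)² / W` of `R(δ_φ)`. -/
def mseHat0 (p n : ℕ) (φ : ℝ → ℝ) (x : EuclideanSpace ℝ (Fin p)) (s : ℝ) : ℝ :=
  p * s / n - s * gFun p n φ (stat x s) + s * φ (stat x s) ^ 2 / stat x s

/-- The truncated estimator `max(0, R̂₀(δ_φ))`. -/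
def mseHatTR (p n : ℕ) (φ : ℝ → ℝ) (x : EuclideanSpace ℝ (Fin p)) (s : ℝ) : ℝ :=
  max 0 (mseHat0 p n φ x s)

/-- `R̂(ψ₀; δ_φ) = min(max(R̂₀(δ_φ), 0), p S (1 + W) / (n + p + 2))`. Where `a(W) > 0` this is
`(p S / n) (1 - a(W) ψ₀(W))`, see `mseHatPsi0_eq`; the closed form also makes sense where
`a(W) ≤ 0`. -/
def mseHatPsi0 (p n : ℕ) (φ : ℝ → ℝ) (x : EuclideanSpace ℝ (Fin p)) (s : ℝ) : ℝ :=
  min (max (mseHat0 p n φ x s) 0) (p * s * (1 + stat x s) / (n + p + 2))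

/-- `ψ₀(w) = max(min(1, 1 / a(w)), (1 / a(w)) (1 - n (1 + w) / (n + p + 2)))`. -/
def psi0 (p n : ℕ) (φ : ℝ → ℝ) (w : ℝ) : ℝ :=
  max (min 1 (1 / aFun p n φ w))
    (1 / aFun p n φ w * (1 - n * (1 + w) / (n + p + 2)))

/-- The set `𝓑`: the `w > 0` with `a(w) > 0` and `(1 / a(w)) (1 - n (1 + w) / (n + p + 2)) > 1`. -/
def setB (p n : ℕ) (φ : ℝ → ℝ) : Set ℝ :=
  {w | 0 < w ∧ 0 < aFun p n φ w ∧
    1 < 1 / aFun p n φ w * (1 - n * (1 + w) / (n + p + 2))}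

/-- The risk `E (R̂(X, S) - R(δ_φ))²`, with values in `[0, ∞]`, of an estimator `R̂` of `R(δ_φ)`. -/
def mseRisk (p n : ℕ) (φ : ℝ → ℝ) (est : EuclideanSpace ℝ (Fin p) → ℝ → ℝ)
    (θ : EuclideanSpace ℝ (Fin p)) (σ : ℝ) : ENNReal :=
  ∫⁻ z, ENNReal.ofReal ((est z.1 z.2 - mse p n φ θ σ) ^ 2) ∂(model p n θ σ)

theorem mseHat0_eq {p n : ℕ} (hp : 0 < p) (hn : 0 < n) (φ : ℝ → ℝ)
    (x : EuclideanSpace ℝ (Fin p)) (s : ℝ) :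
    mseHat0 p n φ x s = p * s / n * (1 - aFun p n φ (stat x s)) := by
  have hp' : (p : ℝ) ≠ 0 := by positivity
  have hn' : (n : ℝ) ≠ 0 := by positivity
  unfold mseHat0 aFun
  generalize stat x s = w
  have : (p : ℝ) * s / n * (n / p * (gFun p n φ w - φ w ^ 2 / w))
      = s * (gFun p n φ w - φ w ^ 2 / w) := by field_simp
  rw [mul_sub, this]
  ring

theorem mseHatPsi0_eq {p n : ℕ} (hp : 0 < p) (hn : 0 < n) (φ : ℝ → ℝ)
    (x : EuclideanSpace ℝ (Fin p)) {s : ℝ} (hs : 0 < s) (ha : 0 < aFun p n φ (stat x s)) :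
    mseHatPsi0 p n φ x s =
      p * s / n * (1 - aFun p n φ (stat x s) * psi0 p n φ (stat x s)) := by
  unfold mseHatPsi0 psi0
  rw [mseHat0_eq hp hn]
  generalize stat x s = w at *
  have hn' : (n : ℝ) ≠ 0 := by positivity
  have hk : 0 ≤ (p : ℝ) * s / n := by positivity
  have h1 : (p : ℝ) * s * (1 + w) / (n + p + 2)
      = p * s / n * (n * (1 + w) / (n + p + 2)) := by field_simp
  have h2 : aFun p n φ w * max (min 1 (1 / aFun p n φ w))
      (1 / aFun p n φ w * (1 - n * (1 + w) / (n + p + 2)))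
      = max (min (aFun p n φ w) 1) (1 - n * (1 + w) / (n + p + 2)) := by
    rw [mul_max_of_nonneg _ _ ha.le, mul_min_of_nonneg _ _ ha.le, mul_one,
      mul_one_div_cancel ha.ne', ← mul_assoc, mul_one_div_cancel ha.ne', one_mul]
  rw [h1, h2]
  have h3 : max ((p : ℝ) * s / n * (1 - aFun p n φ w)) 0
      = p * s / n * max (1 - aFun p n φ w) 0 := by
    rw [mul_max_of_nonneg _ _ hk, mul_zero]
  rw [h3, ← mul_min_of_nonneg _ _ hk]
  congr 1
  rw [← min_sub_sub_left, ← max_sub_sub_left]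
  simp

end ShrinkMSE

end

/-! Write `T` for the truncated estimator, `κ = p / (n + p + 2)` and `b = κ (‖X‖² + S)`. The new
estimator is `min(T, b)`. With `m = max(T - b, 0)`, pointwise `(T - R)² - (min(T, b) - R)² = m² + 2
m (b - R)`, and `m = f(W) S`, where `f` is the positive part of `excess`. So it suffices that `R
E[m] ≤ E[m b]` and `E[m²] > 0`.

Domination of `X` enters only as `R ≤ p σ² = κ σ² (n + p + 2)`. The first inequality then follows
from `σ² (n + p + 2) E[f(W) S] ≤ E[f(W) S (‖X‖² + S)]`, which is `lintegral_stat_moment_le`. This is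
a scaling argument: `W` is invariant under `(x, u) ↦ (r x, r² u)`, so changing variables by `r > 1`
and letting `r → 1` compares the two moments. The noncentral factor only helps, since after
symmetrisation in `x` it is a `cosh`, which increases along rays.

Strictness holds because `excess` is continuous on `(0, ∞)` and positive on `𝓑`, hence positive on a
nonempty open set of values of `W`, which has positive probability. If the risk of `T` is infinite,
it is enough that the risk of `min(T, b)` is finite. -/

namespace ShrinkMSE

/-! ### Lebesgue density of the model, with the scale factored out. -/

/-- Density of the standard Gaussian measure on a Euclidean space. -/
noncomputable def gaussianDensity {p : ℕ} (x : EuclideanSpace ℝ (Fin p)) : ℝ :=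
  (∫ y : EuclideanSpace ℝ (Fin p), Real.exp (-(1 / 2) * ‖y‖ ^ 2))⁻¹ *
    Real.exp (-(1 / 2) * ‖x‖ ^ 2)

theorem integral_exp_neg_half_norm_sq_pos (p : ℕ) :
    0 < ∫ y : EuclideanSpace ℝ (Fin p), Real.exp (-(1 / 2) * ‖y‖ ^ 2) := by
  rw [GaussianFourier.integral_rexp_neg_mul_sq_norm (by norm_num)]
  positivity

theorem gaussianDensity_pos {p : ℕ} (x : EuclideanSpace ℝ (Fin p)) : 0 < gaussianDensity x :=
  mul_pos (inv_pos.2 (integral_exp_neg_half_norm_sq_pos p)) (Real.exp_pos _)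

@[fun_prop]
theorem continuous_gaussianDensity {p : ℕ} :
    Continuous (gaussianDensity : EuclideanSpace ℝ (Fin p) → ℝ) := by
  unfold gaussianDensity
  fun_prop

theorem integrable_gaussianDensity {p : ℕ} :
    Integrable (gaussianDensity : EuclideanSpace ℝ (Fin p) → ℝ) := by
  refine Integrable.const_mul ?_ _
  by_contra h
  have := integral_undef h
  exact (integral_exp_neg_half_norm_sq_pos p).ne' this

/-- Comparison of characteristic functions. The normalising constant is kept as an integral, so it
cancels against the Gaussian Fourier integral. -/
theorem stdGaussian_eq_withDensity (p : ℕ) :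
    stdGaussian (EuclideanSpace ℝ (Fin p)) =
      volume.withDensity (fun x => ENNReal.ofReal (gaussianDensity x)) := by
  have hfin : IsFiniteMeasure ((volume : Measure (EuclideanSpace ℝ (Fin p))).withDensity
      (fun x => ENNReal.ofReal (gaussianDensity x))) :=
    isFiniteMeasure_withDensity_ofReal integrable_gaussianDensity.2
  apply Measure.ext_of_charFun
  ext t
  rw [charFun_stdGaussian, charFun_apply, integral_withDensity_eq_integral_toReal_smul
    (by fun_prop) (by simp)]
  have h0 := GaussianFourier.integral_cexp_neg_mul_sq_norm_add
    (V := EuclideanSpace ℝ (Fin p)) (b := 1 / 2) (by norm_num) 0 0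
  have h1 := GaussianFourier.integral_cexp_neg_mul_sq_norm_add
    (V := EuclideanSpace ℝ (Fin p)) (b := 1 / 2) (by norm_num) Complex.I t
  have hI : ((∫ y : EuclideanSpace ℝ (Fin p), Real.exp (-(1 / 2) * ‖y‖ ^ 2) : ℝ) : ℂ)
      = (Real.pi / (1 / 2) : ℂ) ^ ((Module.finrank ℝ (EuclideanSpace ℝ (Fin p)) : ℂ) / 2) := by
    rw [← integral_complex_ofReal]
    simpa using h0
  have hne := (integral_exp_neg_half_norm_sq_pos p).ne'
  have hne' : ((∫ y : EuclideanSpace ℝ (Fin p), Real.exp (-(1 / 2) * ‖y‖ ^ 2) : ℝ) : ℂ) ≠ 0 := by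
    exact_mod_cast hne
  have : ∀ x : EuclideanSpace ℝ (Fin p), (ENNReal.ofReal (gaussianDensity x)).toReal •
      Complex.exp (↑(inner ℝ x t) * Complex.I) =
      ((∫ y : EuclideanSpace ℝ (Fin p), Real.exp (-(1 / 2) * ‖y‖ ^ 2) : ℝ) : ℂ)⁻¹ *
      Complex.exp (-(1 / 2) * ↑‖x‖ ^ 2 + Complex.I * ↑(inner ℝ t x)) := by
    intro x
    rw [ENNReal.toReal_ofReal (gaussianDensity_pos x).le, gaussianDensity, Complex.exp_add,
      real_inner_comm, Complex.real_smul]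
    push_cast
    ring_nf
  simp_rw [this]
  rw [integral_const_mul, h1, ← hI, ← mul_assoc, inv_mul_cancel₀ hne', one_mul]
  congr 1
  rw [Complex.I_sq]
  ring

theorem multivariateGaussian_smul_one {p : ℕ} (θ : EuclideanSpace ℝ (Fin p)) {σ : ℝ}
    (hσ : 0 < σ) :
    multivariateGaussian θ (σ ^ 2 • (1 : Matrix (Fin p) (Fin p) ℝ)) =
      (stdGaussian (EuclideanSpace ℝ (Fin p))).map (fun x => θ + σ • x) := by
  open scoped MatrixOrder in
  have : CFC.sqrt (σ ^ 2 • (1 : Matrix (Fin p) (Fin p) ℝ)) = σ • 1 := by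
    apply CFC.sqrt_unique
    · simp [pow_two, smul_smul]
    · exact smul_nonneg hσ.le zero_le_one
  rw [multivariateGaussian, this]
  simp

/-- Density of `(X, S)` when `σ = 1` and `X` has mean `η`. -/
noncomputable def modelDensity (p n : ℕ) (η : EuclideanSpace ℝ (Fin p))
    (z : EuclideanSpace ℝ (Fin p) × ℝ) : ℝ :=
  gaussianDensity (z.1 - η) * gammaPDFReal ((n : ℝ) / 2) (1 / 2) z.2

@[fun_prop]
theorem measurable_modelDensity (p n : ℕ) (η : EuclideanSpace ℝ (Fin p)) :
    Measurable (modelDensity p n η) := by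
  unfold modelDensity
  have := continuous_gaussianDensity (p := p)
  have := measurable_gammaPDFReal ((n : ℝ) / 2) (1 / 2)
  fun_prop

/-- The rescaling `(x, u) ↦ (σ x, σ² u)`, which preserves `‖x‖² / u`. -/
noncomputable def rescale {p : ℕ} (σ : ℝ) (z : EuclideanSpace ℝ (Fin p) × ℝ) :
    EuclideanSpace ℝ (Fin p) × ℝ := (σ • z.1, σ ^ 2 * z.2)

@[fun_prop]
theorem continuous_rescale {p : ℕ} (σ : ℝ) :
    Continuous (rescale σ : EuclideanSpace ℝ (Fin p) × ℝ → _) := by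
  unfold rescale
  fun_prop

/-- Since `θ + σ x = σ (x + σ⁻¹ θ)`, translation invariance of Lebesgue measure moves the mean into
the density and leaves a pure dilation. -/
theorem stdGaussian_map_add_smul {p : ℕ} (θ : EuclideanSpace ℝ (Fin p)) {σ : ℝ} (hσ : 0 < σ) :
    (stdGaussian (EuclideanSpace ℝ (Fin p))).map (fun x => θ + σ • x) =
      (volume.withDensity
        (fun x => ENNReal.ofReal (gaussianDensity (x - σ⁻¹ • θ)))).map (fun x => σ • x) := by
  refine Measure.ext_of_lintegral _ fun f hf => ?_
  rw [lintegral_map hf (by fun_prop), lintegral_map hf (by fun_prop), stdGaussian_eq_withDensity,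
    lintegral_withDensity_eq_lintegral_mul _ (by fun_prop) (by fun_prop),
    lintegral_withDensity_eq_lintegral_mul _ (by fun_prop) (by fun_prop),
    ← lintegral_sub_right_eq_self _ (σ⁻¹ • θ)]
  congr 1
  ext x
  simp [smul_sub, smul_smul, hσ.ne']

theorem model_eq_map {p n : ℕ} (hn : 1 ≤ n) (θ : EuclideanSpace ℝ (Fin p)) {σ : ℝ}
    (hσ : 0 < σ) :
    model p n θ σ = ((volume : Measure (EuclideanSpace ℝ (Fin p) × ℝ)).withDensity
      (fun z => ENNReal.ofReal (modelDensity p n (σ⁻¹ • θ) z))).map (rescale σ) := by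
  have hfin : IsFiniteMeasure (chiSquared n) := by
    have := isProbabilityMeasure_gammaMeasure (a := (n : ℝ) / 2) (r := 1 / 2)
      (by positivity) (by norm_num)
    unfold chiSquared
    infer_instance
  rw [model, multivariateGaussian_smul_one θ hσ, stdGaussian_map_add_smul θ hσ,
    Measure.map_prod_map _ _ (by fun_prop) (by fun_prop), chiSquared, gammaMeasure,
    prod_withDensity (by fun_prop) (by unfold gammaPDF; fun_prop)]
  congr 2
  ext z
  rw [modelDensity, ENNReal.ofReal_mul (gaussianDensity_pos _).le, gammaPDF]

theorem lintegral_model {p n : ℕ} (hn : 1 ≤ n) (θ : EuclideanSpace ℝ (Fin p)) {σ : ℝ}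
    (hσ : 0 < σ) {F : EuclideanSpace ℝ (Fin p) × ℝ → ENNReal} (hF : Measurable F) :
    ∫⁻ z, F z ∂(model p n θ σ) =
      ∫⁻ z, ENNReal.ofReal (modelDensity p n (σ⁻¹ • θ) z) * F (rescale σ z) := by
  rw [model_eq_map hn θ hσ, lintegral_map hF (by fun_prop),
    lintegral_withDensity_eq_lintegral_mul _ (by fun_prop) (by fun_prop)]
  rfl

theorem ae_model_pos {p n : ℕ} (hp : 3 ≤ p) (hn : 1 ≤ n) (θ : EuclideanSpace ℝ (Fin p)) {σ : ℝ}
    (hσ : 0 < σ) : ∀ᵐ z ∂(model p n θ σ), z.1 ≠ 0 ∧ 0 < z.2 := by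
  have : Nonempty (Fin p) := ⟨⟨0, by omega⟩⟩
  have hmeas : MeasurableSet {z : EuclideanSpace ℝ (Fin p) × ℝ | z.1 ≠ 0 ∧ 0 < z.2} :=
    ((isOpen_ne.preimage continuous_fst).inter
      (isOpen_Ioi.preimage continuous_snd)).measurableSet
  rw [model_eq_map hn θ hσ, ae_map_iff (by fun_prop) hmeas,
    ae_withDensity_iff (by fun_prop)]
  have h1 : ∀ᵐ z : EuclideanSpace ℝ (Fin p) × ℝ, z.1 ≠ 0 :=
    Measure.quasiMeasurePreserving_fst.ae (Measure.ae_ne volume 0)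
  have h2 : ∀ᵐ z : EuclideanSpace ℝ (Fin p) × ℝ, z.2 ≠ 0 :=
    Measure.quasiMeasurePreserving_snd.ae (Measure.ae_ne volume 0)
  filter_upwards [h1, h2] with z h1 h2 h3
  refine ⟨by simpa [rescale, hσ.ne'] using h1, mul_pos (by positivity) ?_⟩
  refine lt_of_le_of_ne (not_lt.1 fun h => h3 ?_) h2.symm
  rw [modelDensity, gammaPDFReal, if_neg (not_le.2 h)]
  simp

/-! ### Symmetrisation and the moment inequality. -/

/-- The density `modelDensity`, averaged over the reflection `x ↦ -x`. -/
noncomputable def symDensity (p n : ℕ) (η : EuclideanSpace ℝ (Fin p))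
    (z : EuclideanSpace ℝ (Fin p) × ℝ) : ℝ :=
  Real.exp (-(1 / 2) * ‖η‖ ^ 2) * gaussianDensity z.1 * Real.cosh (inner ℝ z.1 η) *
    gammaPDFReal ((n : ℝ) / 2) (1 / 2) z.2

@[fun_prop]
theorem measurable_symDensity (p n : ℕ) (η : EuclideanSpace ℝ (Fin p)) :
    Measurable (symDensity p n η) := by
  unfold symDensity
  have := continuous_gaussianDensity (p := p)
  have := measurable_gammaPDFReal ((n : ℝ) / 2) (1 / 2)
  fun_prop

theorem modelDensity_nonneg {p n : ℕ} (hn : 1 ≤ n) (η : EuclideanSpace ℝ (Fin p))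
    (z : EuclideanSpace ℝ (Fin p) × ℝ) : 0 ≤ modelDensity p n η z :=
  mul_nonneg (gaussianDensity_pos _).le
    (gammaPDFReal_nonneg (by positivity) (by norm_num) _)

theorem symDensity_nonneg {p n : ℕ} (hn : 1 ≤ n) (η : EuclideanSpace ℝ (Fin p))
    (z : EuclideanSpace ℝ (Fin p) × ℝ) : 0 ≤ symDensity p n η z :=
  mul_nonneg (mul_nonneg (mul_nonneg (Real.exp_pos _).le (gaussianDensity_pos _).le)
    (Real.cosh_pos _).le) (gammaPDFReal_nonneg (by positivity) (by norm_num) _)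

/-- Averaging over `±x` replaces `exp ⟨x, η⟩`, which may decrease along a ray, by `cosh ⟨x, η⟩`,
which never does. -/
theorem modelDensity_add_neg {p n : ℕ} (η : EuclideanSpace ℝ (Fin p))
    (z : EuclideanSpace ℝ (Fin p) × ℝ) :
    modelDensity p n η z + modelDensity p n η (-z.1, z.2) = 2 * symDensity p n η z := by
  simp only [modelDensity, symDensity, gaussianDensity, Real.cosh_eq]
  have h1 : Real.exp (-(1 / 2) * ‖z.1 - η‖ ^ 2) = Real.exp (-(1 / 2) * ‖η‖ ^ 2) *
      Real.exp (-(1 / 2) * ‖z.1‖ ^ 2) * Real.exp (inner ℝ z.1 η) := by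
    rw [← Real.exp_add, ← Real.exp_add, norm_sub_sq_real]
    ring_nf
  have h2 : Real.exp (-(1 / 2) * ‖-z.1 - η‖ ^ 2) = Real.exp (-(1 / 2) * ‖η‖ ^ 2) *
      Real.exp (-(1 / 2) * ‖z.1‖ ^ 2) * Real.exp (-inner ℝ z.1 η) := by
    rw [← Real.exp_add, ← Real.exp_add, norm_sub_sq_real, norm_neg, inner_neg_left]
    ring_nf
  rw [h1, h2]
  ring

theorem lintegral_comp_neg_fst {p : ℕ} (F : EuclideanSpace ℝ (Fin p) × ℝ → ENNReal)
    (hF : Measurable F) :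
    ∫⁻ z : EuclideanSpace ℝ (Fin p) × ℝ, F (-z.1, z.2) = ∫⁻ z, F z := by
  have h : MeasurePreserving (fun z : EuclideanSpace ℝ (Fin p) × ℝ => (-z.1, z.2)) :=
    (Measure.measurePreserving_neg (volume : Measure (EuclideanSpace ℝ (Fin p)))).prod
      (MeasurePreserving.id (volume : Measure ℝ))
  exact h.lintegral_comp hF

theorem lintegral_modelDensity_of_even {p n : ℕ} (hn : 1 ≤ n) (η : EuclideanSpace ℝ (Fin p))
    {F : EuclideanSpace ℝ (Fin p) × ℝ → ENNReal} (hF : Measurable F)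
    (heven : ∀ z, F (-z.1, z.2) = F z) :
    ∫⁻ z, ENNReal.ofReal (modelDensity p n η z) * F z =
      ∫⁻ z, ENNReal.ofReal (symDensity p n η z) * F z := by
  have h1 := lintegral_comp_neg_fst (fun z => ENNReal.ofReal (modelDensity p n η z) * F z)
    (by fun_prop)
  simp only [heven] at h1
  have h2 : ∫⁻ z, ENNReal.ofReal (modelDensity p n η z) * F z +
      ENNReal.ofReal (modelDensity p n η (-z.1, z.2)) * F z =
      ∫⁻ z, 2 * (ENNReal.ofReal (symDensity p n η z) * F z) := by
    congr 1
    ext z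
    rw [← add_mul, ← ENNReal.ofReal_add (modelDensity_nonneg hn _ _) (modelDensity_nonneg hn _ _),
      modelDensity_add_neg, ENNReal.ofReal_mul zero_le_two, mul_assoc]
    simp
  rw [lintegral_add_left (by fun_prop), h1, ← two_mul, lintegral_const_mul _ (by fun_prop)] at h2
  exact (ENNReal.mul_right_inj (by norm_num) (by norm_num)).1 h2

theorem lintegral_rescale {p : ℕ} {r : ℝ} (hr : 0 < r)
    {G : EuclideanSpace ℝ (Fin p) × ℝ → ENNReal} (hG : Measurable G) :
    ∫⁻ z, G z = ENNReal.ofReal (r ^ (p + 2)) * ∫⁻ z, G (rescale r z) := by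
  have h : Measure.map (rescale r) (volume : Measure (EuclideanSpace ℝ (Fin p) × ℝ)) =
      ENNReal.ofReal ((r ^ (p + 2))⁻¹) • volume := by
    have h1 := Measure.map_prod_map (f := fun x : EuclideanSpace ℝ (Fin p) => r • x)
      (g := fun u : ℝ => r ^ 2 * u) volume volume (by fun_prop) (by fun_prop)
    rw [Measure.map_addHaar_smul _ hr.ne', Real.map_volume_mul_left (by positivity)] at h1
    rw [Measure.prod_smul_left, Measure.prod_smul_right, smul_smul,
      abs_of_pos (by positivity), abs_of_pos (by positivity),
      ← ENNReal.ofReal_mul (by positivity), finrank_euclideanSpace_fin] at h1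
    rw [pow_add, mul_inv]
    exact h1.symm
  rw [← lintegral_map (g := rescale r) hG (by fun_prop), h, lintegral_smul_measure, smul_eq_mul, ← mul_assoc,
    ← ENNReal.ofReal_mul (by positivity), mul_inv_cancel₀ (by positivity)]
  simp

theorem gaussianDensity_smul {p : ℕ} (r : ℝ) (x : EuclideanSpace ℝ (Fin p)) :
    gaussianDensity (r • x) =
      gaussianDensity x * Real.exp (-((r ^ 2 - 1) / 2 * ‖x‖ ^ 2)) := by
  rw [gaussianDensity, gaussianDensity, mul_assoc, ← Real.exp_add, norm_smul, mul_pow,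
    Real.norm_eq_abs, sq_abs]
  ring_nf

/-- The factor `r ^ 2` on the left keeps the exponent on the right a natural number, also when `n =
1`. -/
theorem gammaPDFReal_half_scale (n : ℕ) {r : ℝ} (hr : 0 < r) (u : ℝ) :
    r ^ 2 * gammaPDFReal ((n : ℝ) / 2) (1 / 2) (r ^ 2 * u) =
      r ^ n * (gammaPDFReal ((n : ℝ) / 2) (1 / 2) u * Real.exp (-((r ^ 2 - 1) / 2 * u))) := by
  have hr2 : (0 : ℝ) < r ^ 2 := by positivity
  by_cases hu : 0 ≤ u
  · rw [gammaPDFReal, gammaPDFReal, if_pos hu, if_pos (by positivity),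
      Real.mul_rpow hr2.le hu]
    have h1 : r ^ 2 * (r ^ 2) ^ ((n : ℝ) / 2 - 1) = r ^ n := by
      rw [Real.rpow_sub_one hr2.ne', mul_div_cancel₀ _ hr2.ne', ← Real.rpow_natCast r 2,
        ← Real.rpow_mul hr.le, ← Real.rpow_natCast r n]
      congr 1
      push_cast
      ring
    have h2 : Real.exp (-(1 / 2 * (r ^ 2 * u))) =
        Real.exp (-(1 / 2 * u)) * Real.exp (-((r ^ 2 - 1) / 2 * u)) := by
      rw [← Real.exp_add]
      ring_nf
    rw [h2, ← h1]
    ring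
  · rw [gammaPDFReal, gammaPDFReal, if_neg hu, if_neg (by simpa [hr2] using hu)]
    simp

/-- Dilating by `r ≥ 1` increases the `cosh` factor and multiplies the rest by a power of `r` and
`exp (-(r² - 1)/2 * (‖x‖² + u))`. Bounding this exponential below by its tangent line makes `‖x‖² +
u` appear linearly. -/
theorem pow_mul_symDensity_le {p n : ℕ} (hn : 1 ≤ n) (η : EuclideanSpace ℝ (Fin p)) {r : ℝ}
    (hr : 1 ≤ r) (z : EuclideanSpace ℝ (Fin p) × ℝ) :
    r ^ n * symDensity p n η z ≤ r ^ 2 * symDensity p n η (rescale r z) +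
      r ^ n * ((r ^ 2 - 1) / 2) * (symDensity p n η z * (‖z.1‖ ^ 2 + z.2)) := by
  have hr0 : 0 < r := by linarith
  have hexp : 1 - (r ^ 2 - 1) / 2 * (‖z.1‖ ^ 2 + z.2) ≤
      Real.exp (-((r ^ 2 - 1) / 2 * ‖z.1‖ ^ 2)) * Real.exp (-((r ^ 2 - 1) / 2 * z.2)) := by
    rw [← Real.exp_add]
    refine le_trans (le_of_eq ?_) (Real.add_one_le_exp _)
    ring
  have hcosh : Real.cosh (inner ℝ z.1 η) ≤ Real.cosh (inner ℝ (r • z.1) η) := by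
    rw [Real.cosh_le_cosh, inner_smul_left, abs_mul]
    simpa [abs_of_pos hr0] using le_mul_of_one_le_left (abs_nonneg (inner ℝ z.1 η)) hr
  set e := Real.exp (-((r ^ 2 - 1) / 2 * ‖z.1‖ ^ 2)) * Real.exp (-((r ^ 2 - 1) / 2 * z.2)) with he
  have he0 : 0 ≤ e := by positivity
  have hg : 0 ≤ gammaPDFReal ((n : ℝ) / 2) (1 / 2) z.2 :=
    gammaPDFReal_nonneg (by positivity) (by norm_num) _
  have hd := (gaussianDensity_pos z.1).le
  have key : r ^ n * (symDensity p n η z * e) ≤ r ^ 2 * symDensity p n η (rescale r z) := by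
    have : r ^ 2 * symDensity p n η (rescale r z) = Real.exp (-(1 / 2) * ‖η‖ ^ 2) *
        gaussianDensity (r • z.1) * Real.cosh (inner ℝ (r • z.1) η) *
        (r ^ 2 * gammaPDFReal ((n : ℝ) / 2) (1 / 2) (r ^ 2 * z.2)) := by
      simp only [symDensity, rescale]
      ring
    rw [this, gammaPDFReal_half_scale n hr0, gaussianDensity_smul]
    have h2 := mul_le_mul_of_nonneg_left hcosh
      (show 0 ≤ r ^ n * (Real.exp (-(1 / 2) * ‖η‖ ^ 2) * gaussianDensity z.1 *
        gammaPDFReal ((n : ℝ) / 2) (1 / 2) z.2 * e) by positivity)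
    rw [he] at h2 ⊢
    simp only [symDensity]
    linarith
  have h3 := mul_le_mul_of_nonneg_left hexp
    (show 0 ≤ r ^ n * symDensity p n η z from
      mul_nonneg (by positivity) (symDensity_nonneg hn η z))
  linarith

/-- Moment inequality under the symmetrised density for functions homogeneous of degree two. -/
theorem lintegral_symDensity_moment_le {p n : ℕ} (hn : 1 ≤ n) (η : EuclideanSpace ℝ (Fin p))
    {F : EuclideanSpace ℝ (Fin p) × ℝ → ENNReal} (hF : Measurable F)
    (hhom : ∀ r : ℝ, 0 < r → ∀ z, F (rescale r z) = ENNReal.ofReal (r ^ 2) * F z)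
    (hfin : ∫⁻ z, ENNReal.ofReal (symDensity p n η z) * F z ≠ ⊤) :
    ENNReal.ofReal (n + p + 2) * ∫⁻ z, ENNReal.ofReal (symDensity p n η z) * F z ≤
      ∫⁻ z, ENNReal.ofReal (symDensity p n η z) * (F z * ENNReal.ofReal (‖z.1‖ ^ 2 + z.2)) := by
  set C := ∫⁻ z, ENNReal.ofReal (symDensity p n η z) * F z with hC
  set D := ∫⁻ z, ENNReal.ofReal (symDensity p n η z) *
    (F z * ENNReal.ofReal (‖z.1‖ ^ 2 + z.2)) with hD
  by_cases hDtop : D = ⊤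
  · rw [hDtop]; exact le_top
  -- The powers of `r` add up to `n + p + 2`: `p + 2` from the Jacobian and `n` from the density,
  -- where the homogeneity of `F` accounts for the `r ^ 2` there.
  have step : ∀ r : ℝ, 1 ≤ r → ENNReal.ofReal (r ^ (n + p + 2)) * C ≤
      C + ENNReal.ofReal (r ^ (n + p + 2) * ((r ^ 2 - 1) / 2)) * D := by
    intro r hr
    have hr0 : 0 < r := by linarith
    have hr1 : 0 ≤ (r ^ 2 - 1) / 2 := by nlinarith
    have hscale : C = ENNReal.ofReal (r ^ (p + 2)) *
        ∫⁻ z, ENNReal.ofReal (r ^ 2 * symDensity p n η (rescale r z)) * F z := by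
      rw [hC, lintegral_rescale hr0 (by fun_prop)]
      congr 2
      ext z
      rw [hhom r hr0, ENNReal.ofReal_mul (by positivity)]
      ring
    have hpt : ENNReal.ofReal (r ^ n) * C ≤
        (∫⁻ z, ENNReal.ofReal (r ^ 2 * symDensity p n η (rescale r z)) * F z) +
          ENNReal.ofReal (r ^ n * ((r ^ 2 - 1) / 2)) * D := by
      rw [hC, hD, ← lintegral_const_mul _ (by fun_prop), ← lintegral_const_mul _ (by fun_prop),
        ← lintegral_add_left (by fun_prop)]
      refine lintegral_mono fun z => ?_
      have h := ENNReal.ofReal_le_ofReal (pow_mul_symDensity_le hn η hr z)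
      have h' := mul_le_mul_left (h.trans ENNReal.ofReal_add_le) (F z)
      rw [add_mul] at h'
      refine le_trans (le_of_eq ?_) (h'.trans (le_of_eq ?_))
      · rw [ENNReal.ofReal_mul (by positivity), mul_assoc]
      · rw [ENNReal.ofReal_mul (p := r ^ n * ((r ^ 2 - 1) / 2)) (by positivity),
          ENNReal.ofReal_mul (symDensity_nonneg hn η z)]
        ring
    have hmul := mul_le_mul_right hpt (ENNReal.ofReal (r ^ (p + 2)))
    rw [mul_add, ← hscale, ← mul_assoc, ← mul_assoc, ← ENNReal.ofReal_mul (by positivity),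
      ← ENNReal.ofReal_mul (by positivity)] at hmul
    refine le_trans (le_of_eq ?_) (hmul.trans (le_of_eq ?_))
    · congr 2; ring
    · congr 3; ring
  lift C to NNReal using hfin with c
  lift D to NNReal using hDtop with d
  have hreal : ∀ r : ℝ, 1 < r →
      ((n : ℝ) + p + 2) * c ≤ r ^ (n + p + 2) * ((r + 1) / 2) * d := by
    intro r hr
    have h := step r hr.le
    have hr0 : 0 < r := by linarith
    have hr1 : 0 ≤ (r ^ 2 - 1) / 2 := by nlinarith
    have h' : r ^ (n + p + 2) * c ≤ c + r ^ (n + p + 2) * ((r ^ 2 - 1) / 2) * d := by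
      have := ENNReal.toReal_mono (by finiteness) h
      rw [ENNReal.toReal_add (by finiteness) (by finiteness), ENNReal.toReal_mul,
        ENNReal.toReal_mul, ENNReal.toReal_ofReal (by positivity),
        ENNReal.toReal_ofReal (by positivity)] at this
      simpa using this
    -- Bernoulli bounds `r ^ (n + p + 2) - 1` below by `(n + p + 2) (r - 1)`; dividing by `r - 1`
    -- and letting `r → 1` replaces differentiation under the integral.
    have hb := one_add_mul_le_pow (a := r - 1) (by linarith) (n + p + 2)
    rw [add_sub_cancel] at hb
    push_cast at hb
    have hc := mul_le_mul_of_nonneg_right hb c.coe_nonneg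
    refine le_of_mul_le_mul_left ?_ (sub_pos.2 hr)
    linarith
  have hlim : ((n : ℝ) + p + 2) * c ≤ d := by
    have hcont : Filter.Tendsto (fun r : ℝ => r ^ (n + p + 2) * ((r + 1) / 2) * d)
        (nhdsWithin 1 (Set.Ioi 1)) (nhds ((1 : ℝ) ^ (n + p + 2) * ((1 + 1) / 2) * d)) :=
      (Continuous.tendsto (by fun_prop) 1).mono_left nhdsWithin_le_nhds
    have := ge_of_tendsto hcont (by
      filter_upwards [self_mem_nhdsWithin] with r hr using hreal r hr)
    simpa using this
  rw [← ENNReal.ofReal_coe_nnreal, ← ENNReal.ofReal_coe_nnreal,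
    ← ENNReal.ofReal_mul (by positivity)]
  exact ENNReal.ofReal_le_ofReal hlim

theorem stat_rescale {p : ℕ} {r : ℝ} (hr : 0 < r) (z : EuclideanSpace ℝ (Fin p) × ℝ) :
    stat (rescale r z).1 (rescale r z).2 = stat z.1 z.2 := by
  simp only [stat, rescale, norm_smul, mul_pow, Real.norm_eq_abs, sq_abs]
  rw [mul_div_mul_left _ _ (by positivity)]

theorem measurable_stat {p : ℕ} :
    Measurable fun z : EuclideanSpace ℝ (Fin p) × ℝ => stat z.1 z.2 := by
  unfold stat
  fun_prop

/-- `σ² (n + p + 2) E[f(W) S] ≤ E[f(W) S (‖X‖² + S)]` for nonnegative `f`. -/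
theorem lintegral_stat_moment_le {p n : ℕ} (hn : 1 ≤ n) (θ : EuclideanSpace ℝ (Fin p)) {σ : ℝ}
    (hσ : 0 < σ) {f : ℝ → ENNReal} (hf : Measurable f)
    (hfin : ∫⁻ z, f (stat z.1 z.2) * ENNReal.ofReal z.2 ∂(model p n θ σ) ≠ ⊤) :
    ENNReal.ofReal (σ ^ 2 * (n + p + 2)) *
        ∫⁻ z, f (stat z.1 z.2) * ENNReal.ofReal z.2 ∂(model p n θ σ) ≤
      ∫⁻ z, f (stat z.1 z.2) * ENNReal.ofReal z.2 *
        ENNReal.ofReal (‖z.1‖ ^ 2 + z.2) ∂(model p n θ σ) := by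
  have hstat := measurable_stat (p := p)
  set F : EuclideanSpace ℝ (Fin p) × ℝ → ENNReal :=
    fun z => f (stat z.1 z.2) * ENNReal.ofReal z.2 with hFdef
  have hF : Measurable F := by fun_prop
  have hhom : ∀ r : ℝ, 0 < r → ∀ z, F (rescale r z) = ENNReal.ofReal (r ^ 2) * F z := by
    intro r hr z
    simp only [hFdef, stat_rescale hr]
    rw [rescale, ENNReal.ofReal_mul (by positivity)]
    ring
  have hnorm : ∀ z : EuclideanSpace ℝ (Fin p) × ℝ, ENNReal.ofReal
      (‖(rescale σ z).1‖ ^ 2 + (rescale σ z).2) =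
      ENNReal.ofReal (σ ^ 2) * ENNReal.ofReal (‖z.1‖ ^ 2 + z.2) := by
    intro z
    rw [← ENNReal.ofReal_mul (by positivity), rescale, norm_smul, mul_pow, Real.norm_eq_abs,
      sq_abs, mul_add]
  -- `F` has degree two under dilation and `F` times `‖x‖² + s` has degree four, so the two sides
  -- differ by exactly one factor `σ²`.
  have hCeq : ∫⁻ z, F z ∂(model p n θ σ) = ENNReal.ofReal (σ ^ 2) *
      ∫⁻ z, ENNReal.ofReal (symDensity p n (σ⁻¹ • θ) z) * F z := by
    rw [lintegral_model hn θ hσ hF, ← lintegral_modelDensity_of_even hn _ hF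
      (by intro z; simp [hFdef, stat]), ← lintegral_const_mul _ (by fun_prop)]
    congr 1
    ext z
    rw [hhom σ hσ]
    ring
  have hDeq : ∫⁻ z, F z * ENNReal.ofReal (‖z.1‖ ^ 2 + z.2) ∂(model p n θ σ) =
      ENNReal.ofReal (σ ^ 2) * ENNReal.ofReal (σ ^ 2) *
      ∫⁻ z, ENNReal.ofReal (symDensity p n (σ⁻¹ • θ) z) *
        (F z * ENNReal.ofReal (‖z.1‖ ^ 2 + z.2)) := by
    rw [lintegral_model hn θ hσ (by fun_prop), ← lintegral_modelDensity_of_even hn _ (by fun_prop)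
      (by intro z; simp [hFdef, stat]), ← lintegral_const_mul _ (by fun_prop)]
    congr 1
    ext z
    rw [hhom σ hσ, hnorm]
    ring
  have hσ2 : ENNReal.ofReal (σ ^ 2) ≠ 0 := by
    simpa using hσ.ne'
  have hfin' : ∫⁻ z, ENNReal.ofReal (symDensity p n (σ⁻¹ • θ) z) * F z ≠ ⊤ := by
    intro h
    exact hfin (by rw [hCeq, h, ENNReal.mul_top hσ2])
  rw [hCeq, hDeq, ENNReal.ofReal_mul (by positivity)]
  have := mul_le_mul_right (lintegral_symDensity_moment_le hn (σ⁻¹ • θ) hF hhom hfin')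
    (ENNReal.ofReal (σ ^ 2) * ENNReal.ofReal (σ ^ 2))
  refine le_trans (le_of_eq ?_) this
  ring

/-! ### Continuity on `(0, ∞)` and the pointwise comparison. -/

theorem continuousOn_gFun {p n : ℕ} {φ : ℝ → ℝ}
    (hint : ∀ w : ℝ, 0 < w → IntegrableOn (gIntegrand p n φ) (Set.Ioi w)) :
    ContinuousOn (gFun p n φ) (Set.Ioi 0) := by
  unfold gFun
  refine ContinuousOn.mul (fun w hw => ?_) (fun w hw => ?_)
  · exact (Real.continuousAt_rpow_const _ _ (Or.inl (ne_of_gt hw))).continuousWithinAt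
  · have hw' : (0 : ℝ) < w := hw
    -- Starting from `w / 2` makes `w` an interior point of the half-line of continuity.
    have h := (hint (w / 2) (by positivity)).continuousOn_Ici_primitive_Ioi
    exact (h.continuousAt (Ici_mem_nhds (by linarith))).continuousWithinAt

theorem continuousOn_of_absolutelyContinuousOnInterval {φ : ℝ → ℝ}
    (hφ : ∀ a b : ℝ, 0 < a → a < b → AbsolutelyContinuousOnInterval φ a b) :
    ContinuousOn φ (Set.Ioi 0) := by
  intro w hw
  have hw' : (0 : ℝ) < w := hw
  have h := (hφ (w / 2) (w + 1) (by positivity) (by linarith)).continuousOn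
  rw [Set.uIcc_of_le (by linarith)] at h
  exact (h.continuousAt (Icc_mem_nhds (by linarith) (by linarith))).continuousWithinAt

theorem continuousOn_aFun {p n : ℕ} {φ : ℝ → ℝ}
    (hφ : ∀ a b : ℝ, 0 < a → a < b → AbsolutelyContinuousOnInterval φ a b)
    (hint : ∀ w : ℝ, 0 < w → IntegrableOn (gIntegrand p n φ) (Set.Ioi w)) :
    ContinuousOn (aFun p n φ) (Set.Ioi 0) := by
  have h1 := continuousOn_gFun hint
  have h2 := continuousOn_of_absolutelyContinuousOnInterval hφ
  have h3 : ∀ w ∈ Set.Ioi (0 : ℝ), w ≠ 0 := fun w hw => ne_of_gt hw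
  unfold aFun
  fun_prop (disch := assumption)

/-- The excess `(p / n) (1 - a(w)) - p (1 + w) / (n + p + 2)`; where it is positive, the minimum
in `mseHatPsi0` truncates. -/
noncomputable def excess (p n : ℕ) (φ : ℝ → ℝ) (w : ℝ) : ℝ :=
  (p : ℝ) / n * (1 - aFun p n φ w) - p * (1 + w) / (n + p + 2)

theorem stat_pos {p : ℕ} {x : EuclideanSpace ℝ (Fin p)} {s : ℝ} (hx : x ≠ 0) (hs : 0 < s) :
    0 < stat x s := div_pos (by positivity) hs

theorem mul_one_add_stat {p : ℕ} (x : EuclideanSpace ℝ (Fin p)) {s : ℝ} (hs : 0 < s) :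
    s * (1 + stat x s) = ‖x‖ ^ 2 + s := by
  unfold stat
  field_simp
  ring

theorem excess_mul {p n : ℕ} (hp : 3 ≤ p) (hn : 1 ≤ n) (φ : ℝ → ℝ)
    (x : EuclideanSpace ℝ (Fin p)) {s : ℝ} (hs : 0 < s) :
    excess p n φ (stat x s) * s =
      mseHat0 p n φ x s - p / (n + p + 2) * (‖x‖ ^ 2 + s) := by
  rw [mseHat0_eq (by omega) (by omega), ← mul_one_add_stat x hs, excess]
  ring

theorem mseHatPsi0_eq_min {p n : ℕ} (φ : ℝ → ℝ) (x : EuclideanSpace ℝ (Fin p)) {s : ℝ}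
    (hs : 0 < s) :
    mseHatPsi0 p n φ x s = min (mseHatTR p n φ x s) (p / (n + p + 2) * (‖x‖ ^ 2 + s)) := by
  rw [mseHatPsi0, mseHatTR, max_comm, ← mul_one_add_stat x hs]
  congr 1
  ring

/-- Pointwise comparison of the two squared errors. -/
theorem sq_error_identity {p n : ℕ} (hp : 3 ≤ p) (hn : 1 ≤ n) (φ : ℝ → ℝ)
    (x : EuclideanSpace ℝ (Fin p)) {s : ℝ} (hs : 0 < s) (R : ℝ) :
    (mseHatTR p n φ x s - R) ^ 2 + 2 * R * (max (excess p n φ (stat x s)) 0 * s) =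
      (mseHatPsi0 p n φ x s - R) ^ 2 + (max (excess p n φ (stat x s)) 0 * s) ^ 2 +
        2 * (p / (n + p + 2)) * (max (excess p n φ (stat x s)) 0 * s * (‖x‖ ^ 2 + s)) := by
  have hb : 0 ≤ (p : ℝ) / (n + p + 2) * (‖x‖ ^ 2 + s) := by positivity
  -- Truncating the unbiased estimator at `0` does not change its excess over the bound, because the
  -- bound is nonnegative.
  have he : max (excess p n φ (stat x s)) 0 * s =
      max (mseHatTR p n φ x s - p / (n + p + 2) * (‖x‖ ^ 2 + s)) 0 := by
    rw [max_mul_of_nonneg _ _ hs.le, zero_mul, excess_mul hp hn φ x hs, mseHatTR]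
    rcases le_total 0 (mseHat0 p n φ x s) with h | h
    · rw [max_eq_right h]
    · rw [max_eq_left h, max_eq_right (by linarith), max_eq_right (by linarith)]
  rw [he, mseHatPsi0_eq_min φ x hs]
  set T := mseHatTR p n φ x s
  rcases le_total T (p / (n + p + 2) * (‖x‖ ^ 2 + s)) with h | h
  · rw [min_eq_left h, max_eq_right (by linarith)]
    ring
  · rw [min_eq_right h, max_eq_left (by linarith)]
    ring

theorem excess_pos_of_mem_setB {p n : ℕ} (hp : 3 ≤ p) (hn : 1 ≤ n) {φ : ℝ → ℝ} {w : ℝ}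
    (hw : w ∈ setB p n φ) : 0 < excess p n φ w := by
  obtain ⟨_, ha, h⟩ := hw
  rw [one_div_mul_eq_div, lt_div_iff₀ ha, one_mul] at h
  have hn' : (0 : ℝ) < n := by exact_mod_cast hn
  have hp' : (0 : ℝ) < p := by exact_mod_cast (show 0 < p by omega)
  have : excess p n φ w = p / n * (1 - n * (1 + w) / (n + p + 2) - aFun p n φ w) := by
    unfold excess
    field_simp
    ring
  rw [this]
  exact mul_pos (by positivity) (by linarith)

/-! ### Moments of the model and finiteness of the improved risk. -/

theorem lintegral_norm_sub_sq_multivariateGaussian {p : ℕ} (θ : EuclideanSpace ℝ (Fin p))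
    (σ : ℝ) :
    ∫⁻ x, ENNReal.ofReal (‖x - θ‖ ^ 2)
      ∂(multivariateGaussian θ (σ ^ 2 • (1 : Matrix (Fin p) (Fin p) ℝ))) =
      ENNReal.ofReal (p * σ ^ 2) := by
  have hS : (σ ^ 2 • (1 : Matrix (Fin p) (Fin p) ℝ)).PosSemidef :=
    Matrix.PosSemidef.one.smul (sq_nonneg σ)
  have h1 : ∀ x : EuclideanSpace ℝ (Fin p), ENNReal.ofReal (‖x - θ‖ ^ 2) =
      ∑ i, ENNReal.ofReal ((x i - θ i) ^ 2) := by
    intro x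
    rw [EuclideanSpace.real_norm_sq_eq, ENNReal.ofReal_sum_of_nonneg (fun i _ => sq_nonneg _)]
    simp
  have h2 : ∀ i, ∫⁻ x : EuclideanSpace ℝ (Fin p), ENNReal.ofReal ((x i - θ i) ^ 2)
      ∂(multivariateGaussian θ (σ ^ 2 • (1 : Matrix (Fin p) (Fin p) ℝ))) =
      ENNReal.ofReal (σ ^ 2) := by
    intro i
    have hm := measurePreserving_eval_multivariateGaussian (μ := θ) hS (i := i)
    rw [hm.lintegral_comp (f := fun y => ENNReal.ofReal ((y - θ i) ^ 2)) (by fun_prop),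
      ← ofReal_integral_eq_lintegral_ofReal _ (ae_of_all _ fun y => sq_nonneg _)]
    · have hv := variance_eq_integral (X := fun y : ℝ => y)
        (μ := gaussianReal (θ i) ((σ ^ 2 • (1 : Matrix (Fin p) (Fin p) ℝ)) i i).toNNReal)
        (by fun_prop)
      rw [variance_fun_id_gaussianReal, integral_id_gaussianReal] at hv
      rw [← hv]
      simp [sq_nonneg]
    · exact ((memLp_id_gaussianReal 2).sub (memLp_const (θ i))).integrable_sq
  simp_rw [h1]
  rw [lintegral_finsetSum _ (fun i _ => by fun_prop)]
  simp_rw [h2]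
  rw [ENNReal.ofReal_mul (by positivity)]
  simp

instance isProbabilityMeasure_chiSquared_map {n : ℕ} [NeZero n] (σ : ℝ) :
    IsProbabilityMeasure ((chiSquared n).map (fun u => σ ^ 2 * u)) := by
  have hn : 0 < n := Nat.pos_of_ne_zero (NeZero.ne n)
  have := isProbabilityMeasure_gammaMeasure (a := (n : ℝ) / 2) (r := 1 / 2)
      (by positivity) (by norm_num)
  have : IsProbabilityMeasure (chiSquared n) := this
  exact Measure.isProbabilityMeasure_map (μ := chiSquared n) (by fun_prop)

instance isProbabilityMeasure_model {p n : ℕ} [NeZero n] (θ : EuclideanSpace ℝ (Fin p)) (σ : ℝ) :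
    IsProbabilityMeasure (model p n θ σ) := by
  unfold model
  infer_instance

theorem lintegral_model_fst {p n : ℕ} [NeZero n] (θ : EuclideanSpace ℝ (Fin p)) (σ : ℝ)
    {F : EuclideanSpace ℝ (Fin p) → ENNReal} (hF : Measurable F) :
    ∫⁻ z, F z.1 ∂(model p n θ σ) = ∫⁻ x, F x
      ∂(multivariateGaussian θ (σ ^ 2 • (1 : Matrix (Fin p) (Fin p) ℝ))) := by
  unfold model
  exact measurePreserving_fst.lintegral_comp hF

theorem lintegral_model_snd {p n : ℕ} [NeZero n] (θ : EuclideanSpace ℝ (Fin p)) (σ : ℝ)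
    {F : ℝ → ENNReal} (hF : Measurable F) :
    ∫⁻ z, F z.2 ∂(model p n θ σ) = ∫⁻ u, F (σ ^ 2 * u) ∂(chiSquared n) := by
  unfold model
  rw [measurePreserving_snd.lintegral_comp hF, lintegral_map hF (by fun_prop)]

theorem mse_nonneg {p n : ℕ} (φ : ℝ → ℝ) (θ : EuclideanSpace ℝ (Fin p)) (σ : ℝ) :
    0 ≤ mse p n φ θ σ := ENNReal.toReal_nonneg

theorem mse_le {p n : ℕ} [NeZero n] {φ : ℝ → ℝ} {θ : EuclideanSpace ℝ (Fin p)} {σ : ℝ}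
    (himp : sqRisk p n (shrink φ) θ σ ≤ sqRisk p n (fun x _ => x) θ σ) :
    mse p n φ θ σ ≤ p * σ ^ 2 := by
  have h : sqRisk p n (fun x _ => x) θ σ = ENNReal.ofReal (p * σ ^ 2) := by
    rw [sqRisk, lintegral_model_fst θ σ (F := fun x => ENNReal.ofReal (‖x - θ‖ ^ 2))
      (by fun_prop), lintegral_norm_sub_sq_multivariateGaussian]
  rw [h] at himp
  exact ENNReal.toReal_le_of_le_ofReal (by positivity) himp

/-- Multiplying the gamma density of shape `n / 2` by `u²` gives a constant times the gamma density
of shape `n / 2 + 2`. -/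
theorem lintegral_sq_chiSquared_lt_top {n : ℕ} (hn : 1 ≤ n) :
    ∫⁻ u, ENNReal.ofReal (u ^ 2) ∂(chiSquared n) < ⊤ := by
  have ha : (0 : ℝ) < (n : ℝ) / 2 := by positivity
  have hG : 0 < Real.Gamma ((n : ℝ) / 2) := Real.Gamma_pos_of_pos ha
  have hG2 : 0 < Real.Gamma ((n : ℝ) / 2 + 2) := Real.Gamma_pos_of_pos (by positivity)
  set c : ℝ := 4 * Real.Gamma ((n : ℝ) / 2 + 2) / Real.Gamma ((n : ℝ) / 2) with hc
  have hpdf : ∀ u : ℝ, u ≠ 0 → gammaPDF ((n : ℝ) / 2) (1 / 2) u * ENNReal.ofReal (u ^ 2) =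
      ENNReal.ofReal c * gammaPDF ((n : ℝ) / 2 + 2) (1 / 2) u := by
    intro u hu
    rcases lt_or_gt_of_ne hu with h | h
    · rw [gammaPDF_of_neg h, gammaPDF_of_neg h]; simp
    · rw [gammaPDF_of_nonneg h.le, gammaPDF_of_nonneg h.le, ← ENNReal.ofReal_mul (by positivity),
        ← ENNReal.ofReal_mul (by positivity)]
      congr 1
      have h1 : u ^ ((n : ℝ) / 2 + 2 - 1) = u ^ ((n : ℝ) / 2 - 1) * u ^ 2 := by
        rw [← Real.rpow_natCast u 2, ← Real.rpow_add h]
        congr 1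
        push_cast
        ring
      have h2 : (1 / 2 : ℝ) ^ ((n : ℝ) / 2 + 2) = (1 / 2 : ℝ) ^ ((n : ℝ) / 2) * (1 / 4) := by
        rw [Real.rpow_add (by norm_num), Real.rpow_two]
        norm_num
      rw [h1, h2, hc]
      field_simp
  rw [chiSquared, gammaMeasure, lintegral_withDensity_eq_lintegral_mul _
    (by unfold gammaPDF; fun_prop) (by fun_prop)]
  have : ∫⁻ u, (gammaPDF ((n : ℝ) / 2) (1 / 2) * fun u => ENNReal.ofReal (u ^ 2)) u =
      ∫⁻ u, ENNReal.ofReal c * gammaPDF ((n : ℝ) / 2 + 2) (1 / 2) u := by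
    refine lintegral_congr_ae ?_
    filter_upwards [Measure.ae_ne volume (0 : ℝ)] with u hu
    exact hpdf u hu
  rw [this, lintegral_const_mul _ (by unfold gammaPDF; fun_prop),
    lintegral_gammaPDF_eq_one (by positivity) (by norm_num)]
  simp

theorem lintegral_norm_sq_add_sq_model_lt_top {p n : ℕ} [NeZero n]
    (θ : EuclideanSpace ℝ (Fin p)) (σ : ℝ) :
    ∫⁻ z, ENNReal.ofReal ((‖z.1‖ ^ 2 + z.2) ^ 2) ∂(model p n θ σ) < ⊤ := by
  have hn : 1 ≤ n := Nat.pos_of_ne_zero (NeZero.ne n)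
  have h4 : ∫⁻ z, ENNReal.ofReal (‖z.1‖ ^ 4) ∂(model p n θ σ) < ⊤ := by
    rw [lintegral_model_fst θ σ (F := fun x => ENNReal.ofReal (‖x‖ ^ 4)) (by fun_prop)]
    have h := (IsGaussian.memLp_id (multivariateGaussian θ
      (σ ^ 2 • (1 : Matrix (Fin p) (Fin p) ℝ))) 4 (by norm_num)).integrable_norm_pow (p := 4)
      (by norm_num)
    simp only [id] at h
    rw [← ofReal_integral_eq_lintegral_ofReal h (ae_of_all _ fun x => by positivity)]
    exact ENNReal.ofReal_lt_top
  have h2 : ∫⁻ z, ENNReal.ofReal (z.2 ^ 2) ∂(model p n θ σ) < ⊤ := by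
    rw [lintegral_model_snd θ σ (F := fun s => ENNReal.ofReal (s ^ 2)) (by fun_prop)]
    simp_rw [mul_pow, ENNReal.ofReal_mul (show 0 ≤ (σ ^ 2) ^ 2 by positivity)]
    rw [lintegral_const_mul _ (by fun_prop)]
    exact ENNReal.mul_lt_top ENNReal.ofReal_lt_top (lintegral_sq_chiSquared_lt_top hn)
  calc ∫⁻ z, ENNReal.ofReal ((‖z.1‖ ^ 2 + z.2) ^ 2) ∂(model p n θ σ)
      ≤ ∫⁻ z, ENNReal.ofReal 2 * ENNReal.ofReal (‖z.1‖ ^ 4) + ENNReal.ofReal 2 * ENNReal.ofReal (z.2 ^ 2)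
          ∂(model p n θ σ) := by
        refine lintegral_mono fun z => ?_
        rw [← ENNReal.ofReal_mul (by norm_num),
          ← ENNReal.ofReal_mul (by norm_num), ← ENNReal.ofReal_add (by positivity) (by positivity)]
        refine ENNReal.ofReal_le_ofReal ?_
        nlinarith [sq_nonneg (‖z.1‖ ^ 2 - z.2)]
    _ < ⊤ := by
        rw [lintegral_add_left (by fun_prop), lintegral_const_mul _ (by fun_prop),
          lintegral_const_mul _ (by fun_prop)]
        finiteness

/-- The estimator lies between `0` and a multiple of `‖X‖² + S`, which has a finite second moment
whatever `φ` is. -/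
theorem mseRisk_mseHatPsi0_lt_top {p n : ℕ} [NeZero n] (hp : 3 ≤ p) (φ : ℝ → ℝ)
    (θ : EuclideanSpace ℝ (Fin p)) {σ : ℝ} (hσ : 0 < σ) :
    mseRisk p n φ (mseHatPsi0 p n φ) θ σ < ⊤ := by
  have hn : 1 ≤ n := Nat.pos_of_ne_zero (NeZero.ne n)
  set R := mse p n φ θ σ with hR
  set c : ℝ := 2 * ((p : ℝ) / (n + p + 2)) ^ 2 with hc
  have hc0 : 0 ≤ c := by positivity
  calc mseRisk p n φ (mseHatPsi0 p n φ) θ σ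
      ≤ ∫⁻ z, ENNReal.ofReal c * ENNReal.ofReal ((‖z.1‖ ^ 2 + z.2) ^ 2) +
          ENNReal.ofReal (2 * R ^ 2) ∂(model p n θ σ) := by
        refine lintegral_mono_ae ?_
        filter_upwards [ae_model_pos hp hn θ hσ] with z hz
        rw [← ENNReal.ofReal_mul hc0, ← ENNReal.ofReal_add (by positivity) (by positivity)]
        refine ENNReal.ofReal_le_ofReal ?_
        rw [mseHatPsi0_eq_min φ z.1 hz.2]
        set b := (p : ℝ) / (n + p + 2) * (‖z.1‖ ^ 2 + z.2) with hb
        have hb0 : 0 ≤ b := by have := hz.2; positivity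
        have hT : 0 ≤ mseHatTR p n φ z.1 z.2 := le_max_left _ _
        have h1 : 0 ≤ min (mseHatTR p n φ z.1 z.2) b := le_min hT hb0
        have h2 : min (mseHatTR p n φ z.1 z.2) b ^ 2 ≤ b ^ 2 :=
          pow_le_pow_left₀ h1 (min_le_right _ _) 2
        have h3 : c * (‖z.1‖ ^ 2 + z.2) ^ 2 = 2 * b ^ 2 := by rw [hc, hb]; ring
        rw [h3]
        nlinarith [sq_nonneg (min (mseHatTR p n φ z.1 z.2) b + R)]
    _ < ⊤ := by
        have := lintegral_norm_sq_add_sq_model_lt_top (n := n) θ σ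
        rw [lintegral_add_left (by fun_prop), lintegral_const_mul _ (by fun_prop)]
        simp only [lintegral_const, measure_univ]
        finiteness

/-! ### Ingredients for strictness and for cancellation in `[0, ∞]`. -/

/-- A nonnegative function of `(W, S)` that is positive when `W` lies in a nonempty open subset of
`(0, ∞)` has positive integral. -/
theorem lintegral_model_ne_zero_of_stat {p n : ℕ} (hp : 3 ≤ p) (hn : 1 ≤ n)
    (θ : EuclideanSpace ℝ (Fin p)) {σ : ℝ} (hσ : 0 < σ) {U : Set ℝ} (hU : IsOpen U)
    (hpos : U ⊆ Set.Ioi 0) (hne : U.Nonempty) {F : EuclideanSpace ℝ (Fin p) × ℝ → ENNReal}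
    (hF : Measurable F) (hFU : ∀ z, 0 < z.2 → stat z.1 z.2 ∈ U → F z ≠ 0) :
    ∫⁻ z, F z ∂(model p n θ σ) ≠ 0 := by
  rw [lintegral_model hn θ hσ hF]
  intro h0
  have h := (lintegral_eq_zero_iff (by fun_prop)).1 h0
  set V : Set (EuclideanSpace ℝ (Fin p) × ℝ) := {z | 0 < z.2 ∧ stat z.1 z.2 ∈ U} with hV
  have hVopen : IsOpen V := by
    have hcont : ContinuousOn (fun z : EuclideanSpace ℝ (Fin p) × ℝ => stat z.1 z.2)
        {z | 0 < z.2} := by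
      unfold stat
      exact ContinuousOn.div (by fun_prop) (by fun_prop) fun z hz => ne_of_gt hz
    exact hcont.isOpen_inter_preimage (isOpen_Ioi.preimage continuous_snd) hU
  have hVne : V.Nonempty := by
    obtain ⟨w, hw⟩ := hne
    -- A point with `‖x‖² = w` and `s = 1`, so that the statistic equals `w`.
    refine ⟨(EuclideanSpace.single ⟨0, by omega⟩ (Real.sqrt w), 1), by simp, ?_⟩
    have : (0 : ℝ) ≤ w := (hpos hw).le
    simpa [stat, Real.sq_sqrt this] using hw
  refine (hVopen.measure_pos volume hVne).ne' (measure_mono_null ?_ h)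
  intro z hz hz0
  have hs : 0 < z.2 := hz.1
  have hd : 0 < modelDensity p n (σ⁻¹ • θ) z :=
    mul_pos (gaussianDensity_pos _) (gammaPDFReal_pos (by positivity) (by norm_num) hs)
  have h1 := hFU (rescale σ z) (mul_pos (by positivity) hs) (by rw [stat_rescale hσ]; exact hz.2)
  have hz0' : ENNReal.ofReal (modelDensity p n (σ⁻¹ • θ) z) * F (rescale σ z) = 0 := hz0
  rw [mul_eq_zero] at hz0'
  exact hz0'.elim (fun h => (ENNReal.ofReal_pos.2 hd).ne' h) h1

theorem continuousOn_excess {p n : ℕ} {φ : ℝ → ℝ}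
    (hφ : ∀ a b : ℝ, 0 < a → a < b → AbsolutelyContinuousOnInterval φ a b)
    (hint : ∀ w : ℝ, 0 < w → IntegrableOn (gIntegrand p n φ) (Set.Ioi w)) :
    ContinuousOn (excess p n φ) (Set.Ioi 0) := by
  have := continuousOn_aFun hφ hint
  unfold excess
  fun_prop

theorem measurable_indicator_excess {p n : ℕ} {φ : ℝ → ℝ}
    (hcont : ContinuousOn (excess p n φ) (Set.Ioi 0)) :
    Measurable ((Set.Ioi 0).indicator (excess p n φ)) := by
  classical
  rw [← Set.piecewise_eq_indicator]
  exact hcont.measurable_piecewise continuousOn_const measurableSet_Ioi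

/-- The integrand is at most `T`, and `T ≤ 1 + T² ≤ 1 + 2 (T - R)² + 2 R²`. This finiteness is
needed for the moment inequality and for the final cancellation. -/
theorem lintegral_excess_ne_top {p n : ℕ} [NeZero n] (hp : 3 ≤ p) (φ : ℝ → ℝ)
    (θ : EuclideanSpace ℝ (Fin p)) {σ : ℝ} (hσ : 0 < σ)
    (hfin : mseRisk p n φ (mseHatTR p n φ) θ σ ≠ ⊤) :
    ∫⁻ z, ENNReal.ofReal (max (excess p n φ (stat z.1 z.2)) 0 * z.2) ∂(model p n θ σ) ≠ ⊤ := by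
  have hn : 1 ≤ n := Nat.pos_of_ne_zero (NeZero.ne n)
  set R := mse p n φ θ σ with hR
  refine ne_top_of_le_ne_top (b := ∫⁻ z, ENNReal.ofReal 2 *
    ENNReal.ofReal ((mseHatTR p n φ z.1 z.2 - R) ^ 2) + ENNReal.ofReal (1 + 2 * R ^ 2)
      ∂(model p n θ σ)) ?_ (lintegral_mono_ae ?_)
  · rw [lintegral_add_right _ measurable_const, lintegral_const_mul' _ _ (by simp)]
    simp only [lintegral_const, measure_univ]
    unfold mseRisk at hfin
    finiteness
  · filter_upwards [ae_model_pos hp hn θ hσ] with z hz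
    rw [← ENNReal.ofReal_mul zero_le_two, ← ENNReal.ofReal_add (by positivity) (by positivity)]
    refine ENNReal.ofReal_le_ofReal ?_
    have hs := hz.2
    set T := mseHatTR p n φ z.1 z.2 with hT
    have hT0 : 0 ≤ T := le_max_left _ _
    have hb : 0 ≤ (p : ℝ) / (n + p + 2) * (‖z.1‖ ^ 2 + z.2) := by positivity
    have h1 : max (excess p n φ (stat z.1 z.2)) 0 * z.2 ≤ T := by
      rw [max_mul_of_nonneg _ _ hs.le, zero_mul, excess_mul hp hn φ z.1 hs]
      refine max_le ?_ hT0
      have : mseHat0 p n φ z.1 z.2 ≤ T := le_max_right _ _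
      linarith
    nlinarith [sq_nonneg (T - 2 * R), sq_nonneg (T - 1)]

end ShrinkMSE

/-! ### Comparison of the risks. -/

open ShrinkMSE in
theorem mainTheorem7 (p n : ℕ) (hp : 3 ≤ p) (hn : 1 ≤ n) (φ : ℝ → ℝ)
    (hφ : ∀ a b : ℝ, 0 < a → a < b → AbsolutelyContinuousOnInterval φ a b)
    (hint : ∀ w : ℝ, 0 < w →
      MeasureTheory.IntegrableOn (ShrinkMSE.gIntegrand p n φ) (Set.Ioi w))
    (himp : ∀ (θ : EuclideanSpace ℝ (Fin p)) (σ : ℝ), 0 < σ →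
      ShrinkMSE.sqRisk p n (ShrinkMSE.shrink φ) θ σ ≤
        ShrinkMSE.sqRisk p n (fun x _ => x) θ σ)
    (hB : (ShrinkMSE.setB p n φ).Nonempty) :
    ∀ (θ : EuclideanSpace ℝ (Fin p)) (σ : ℝ), 0 < σ →
      ShrinkMSE.mseRisk p n φ (ShrinkMSE.mseHatPsi0 p n φ) θ σ <
        ShrinkMSE.mseRisk p n φ (ShrinkMSE.mseHatTR p n φ) θ σ := by
  intro θ σ hσ
  have : NeZero n := ⟨by omega⟩
  have hL := mseRisk_mseHatPsi0_lt_top (n := n) hp φ θ hσ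
  by_cases hA : mseRisk p n φ (mseHatTR p n φ) θ σ = ⊤
  · rwa [hA]
  have hcont := continuousOn_excess hφ hint
  -- Continuity is known only on `(0, ∞)`; the indicator gives a function measurable on all of `ℝ`,
  -- and `W > 0` almost surely.
  set e := (Set.Ioi 0).indicator (excess p n φ) with he
  have he_meas : Measurable e := measurable_indicator_excess hcont
  have hstat := measurable_stat (p := p)
  set f : ℝ → ENNReal := fun w => ENNReal.ofReal (e w) with hf
  have hf_meas : Measurable f := by fun_prop
  set F : EuclideanSpace ℝ (Fin p) × ℝ → ENNReal :=
    fun z => f (stat z.1 z.2) * ENNReal.ofReal z.2 with hF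
  have hF_meas : Measurable F := by fun_prop
  have hFeq : ∀ᵐ z ∂(model p n θ σ),
      F z = ENNReal.ofReal (max (excess p n φ (stat z.1 z.2)) 0 * z.2) := by
    filter_upwards [ae_model_pos hp hn θ hσ] with z hz
    have hw : stat z.1 z.2 ∈ Set.Ioi (0 : ℝ) := stat_pos hz.1 hz.2
    simp only [hF, hf, he, Set.indicator_of_mem hw]
    rw [ENNReal.ofReal_mul (le_max_right _ _), ENNReal.ofReal_max, ENNReal.ofReal_zero,
      max_eq_left zero_le]
  have hC : ∫⁻ z, F z ∂(model p n θ σ) ≠ ⊤ := by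
    rw [lintegral_congr_ae hFeq]
    exact lintegral_excess_ne_top hp φ θ hσ hA
  have hQ : ∫⁻ z, F z ^ 2 ∂(model p n θ σ) ≠ 0 := by
    refine lintegral_model_ne_zero_of_stat hp hn θ hσ
      (U := Set.Ioi 0 ∩ excess p n φ ⁻¹' Set.Ioi 0)
      (hcont.isOpen_inter_preimage isOpen_Ioi isOpen_Ioi) Set.inter_subset_left ?_
      (by fun_prop) fun z hs hz => ?_
    · obtain ⟨w, hw⟩ := hB
      exact ⟨w, hw.1, excess_pos_of_mem_setB hp hn hw⟩
    · simp only [hF, hf, he, Set.indicator_of_mem hz.1]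
      exact pow_ne_zero 2 (mul_ne_zero (ENNReal.ofReal_pos.2 hz.2).ne'
        (ENNReal.ofReal_pos.2 hs).ne')
  set R := mse p n φ θ σ with hR
  have hR0 : 0 ≤ R := mse_nonneg φ θ σ
  have hRle : R ≤ p * σ ^ 2 := mse_le (himp θ σ hσ)
  set κ : ℝ := (p : ℝ) / (n + p + 2) with hκ
  have hκ0 : 0 ≤ κ := by positivity
  have hmom := lintegral_stat_moment_le hn θ hσ hf_meas hC
  set C := ∫⁻ z, F z ∂(model p n θ σ) with hCdef
  set D := ∫⁻ z, F z * ENNReal.ofReal (‖z.1‖ ^ 2 + z.2) ∂(model p n θ σ) with hD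
  set Q := ∫⁻ z, F z ^ 2 ∂(model p n θ σ) with hQdef
  -- The integrated pointwise identity, arranged with nonnegative terms on both sides to avoid
  -- subtraction in `[0, ∞]`.
  have hident : mseRisk p n φ (mseHatTR p n φ) θ σ + ENNReal.ofReal (2 * R) * C =
      mseRisk p n φ (mseHatPsi0 p n φ) θ σ + Q + ENNReal.ofReal (2 * κ) * D := by
    rw [mseRisk, mseRisk, hCdef, hQdef, hD, ← lintegral_const_mul _ hF_meas,
      ← lintegral_const_mul _ (by fun_prop), ← lintegral_add_right _ (by fun_prop),
      ← lintegral_add_right _ (by fun_prop), ← lintegral_add_right _ (by fun_prop)]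
    refine lintegral_congr_ae ?_
    filter_upwards [ae_model_pos hp hn θ hσ, hFeq] with z hz hFz
    have hs := hz.2
    have hm : 0 ≤ max (excess p n φ (stat z.1 z.2)) 0 * z.2 :=
      mul_nonneg (le_max_right _ _) hs.le
    rw [hFz, ← ENNReal.ofReal_pow hm, ← ENNReal.ofReal_mul (by positivity),
      ← ENNReal.ofReal_mul hm, ← ENNReal.ofReal_mul (by positivity),
      ← ENNReal.ofReal_add (by positivity) (by positivity),
      ← ENNReal.ofReal_add (by positivity) (by positivity),
      ← ENNReal.ofReal_add (by positivity) (by positivity),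
      sq_error_identity hp hn φ z.1 hs]
  have hCD : ENNReal.ofReal (2 * R) * C ≤ ENNReal.ofReal (2 * κ) * D := by
    calc ENNReal.ofReal (2 * R) * C
        -- Here `κ σ² (n + p + 2) = p σ²`; this fixes the constant `n + p + 2` in the truncation.
        ≤ ENNReal.ofReal (2 * κ * (σ ^ 2 * (n + p + 2))) * C := by
          refine mul_le_mul_left (ENNReal.ofReal_le_ofReal ?_) C
          refine (mul_le_mul_of_nonneg_left hRle zero_le_two).trans (le_of_eq ?_)
          rw [hκ]
          field_simp
      _ = ENNReal.ofReal (2 * κ) * (ENNReal.ofReal (σ ^ 2 * (n + p + 2)) * C) := by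
          rw [ENNReal.ofReal_mul (by positivity), mul_assoc]
      _ ≤ ENNReal.ofReal (2 * κ) * D := by gcongr
  have hle : mseRisk p n φ (mseHatPsi0 p n φ) θ σ + Q ≤
      mseRisk p n φ (mseHatTR p n φ) θ σ := by
    have hfin : ENNReal.ofReal (2 * R) * C ≠ ⊤ := by finiteness
    refine (ENNReal.add_le_add_iff_right hfin).1 ?_
    rw [hident]
    gcongr
  exact (ENNReal.lt_add_right hL.ne hQ).trans_le hle
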